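/- \textbf{Proposition (GSE matrices).} Let \(N,n\) be non-negative integers, \([n]=\{1,\dots,n\}\) and \(\pm[n]=\{-n,\dots,-1,1,\dots,n\}\). \emph{Random matrices.} Represent a quaternion \(Q=a+bi+cj+dk\) (\(a,b,c,d\in\mathbb R\)) by the complex matrix \[\begin{pmatrix} a+bi & c+di\\ -c+di & a-bi\end{pmatrix},\] whose rows and columns are indexed by \(1,-1\), in this order. For an \(N\times N\) quaternionic matrix \(A\), denote by \(A_{ij;\eta\theta}\in\mathbb C\) the entry with row \(\eta\) and column \(\theta\) (\(\eta,\theta\in\{1,-1\}\)) of the matrix representing the quaternion \(A_{ij}\). A standard quaternionic Gaussian random variable is \(\xi_0+i\xi_1+j\xi_2+k\xi_3\) with \(\xi_0,\dots,\xi_3\) independent real \(N(0,\tfrac14)\) random variables. Let \(G\) be an \(N\times N\) random matrix whose entries are independent standard quaternionic Gaussian random variables, let \(G^*\) be its conjugate transpose, and let \(T=\frac{1}{\sqrt{2N}}(G+G^*)\) (a GSE matrix). \emph{Permutations.} Let \(\delta(k)=-k\) on \(\pm[n]\), and let \(\mathrm{PM}(n)\) be the set of permutations \(\alpha\) of \(\pm[n]\)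 such that \(\delta\alpha\delta=\alpha^{-1}\) and such that, for every \(k\), the elements \(k\) and \(-k\) lie in different cycles of \(\alpha\). Let \(\#(\alpha)\) be the number of cycles of \(\alpha\) on \(\pm[n]\), fixed points included, and let \(\mathrm{FD}(\alpha)\) be the set of elements of those cycles of \(\alpha\) in which the integer of smallest absolute value is positive. Let \(f(\alpha)=1\) if \(\alpha\) is a pairing (every cycle of \(\alpha\) has exactly two elements), and \(f(\alpha)=0\) otherwise. Denote by \(\mathrm{sgn}(k)\in\{1,-1\}\) the sign of \(k\in\pm[n]\). \emph{Claim.} For all \(\iota:\pm[n]\to[N]\) and \(\eta:\pm[n]\to\{1,-1\}\), the random variable \(\prod_{k=1}^n T_{\iota_k\iota_{-k};\eta_k\eta_{-k}}\) is integrable and \[\mathbb E\Bigl(\prod_{k=1}^n T_{\iota_k\iota_{-k};\eta_k\eta_{-k}}\Bigr)=\sum_{\alpha}\Bigl[\prod_{\substack{k\in[n]\\ -k\in\mathrm{FD}(\alpha)}}\eta_k\eta_{-k}\Bigr](2N)^{\#(\alpha)/2-n}f(\alpha),\] where the sum is over all \(\alpha\in\mathrm{PM}(n)\) such that \(\iota_k=\iota_{-\alpha(k)}\)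 and \(\mathrm{sgn}(k)\,\eta_k=\mathrm{sgn}(\alpha(k))\,\eta_{-\alpha(k)}\) for all \(k\in\pm[n]\). -/

import Mathlib

open MeasureTheory ProbabilityTheory
open scoped Quaternion Matrix

/-! ### The index set `±[n]` and its permutations -/

/-- The set `±[n] = {-n, …, -1, 1, …, n}`: the pair `(k, s)` with `k : Fin n` and `s = ±1`
stands for the integer `s * (k + 1)`. So `Prod.fst` encodes the absolute value (order included)
and `Prod.snd` is the sign. -/
abbrev PMIdx (n : ℕ) : Type := Fin n × ℤˣ

namespace PMIdx

variable {n : ℕ}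

/-- The element `k` of `[n] ⊆ ±[n]`. -/
def pos (k : Fin n) : PMIdx n := (k, 1)

/-- The element `-k` of `±[n]`, for `k` in `[n]`. -/
def neg (k : Fin n) : PMIdx n := (k, -1)

/-- The sign of an element of `±[n]`. -/
def sgn (k : PMIdx n) : ℤˣ := k.2

/-- The absolute value of an element of `±[n]`, as an element of `[n]`. -/
def abs (k : PMIdx n) : Fin n := k.1

/-- The involution `δ : k ↦ -k` of `±[n]`. -/
def delta (n : ℕ) : Equiv.Perm (PMIdx n) where
  toFun k := (k.1, -k.2)
  invFun k := (k.1, -k.2)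
  left_inv k := by simp
  right_inv k := by simp

/-- `α ∈ PM(n)`: `δ α δ = α⁻¹`, and `k` and `-k` are never in the same cycle of `α`. -/
def IsPM (α : Equiv.Perm (PMIdx n)) : Prop :=
  delta n * α * delta n = α⁻¹ ∧ ∀ k, ¬ α.SameCycle k (delta n k)

/-- The set of elements appearing in the cycles of `FD(α)`: those `k` for which the integer of
smallest absolute value in the cycle of `k` is positive. -/
def FD (α : Equiv.Perm (PMIdx n)) : Set (PMIdx n) :=
  {k | ∃ m, α.SameCycle k m ∧ (∀ l, α.SameCycle k l → m.abs ≤ l.abs) ∧ m.sgn = 1}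

/-- The number `#(α)` of cycles (orbits, fixed points included) of `α` on `±[n]`. -/
noncomputable def numCycles (α : Equiv.Perm (PMIdx n)) : ℕ :=
  Nat.card (Quotient (Equiv.Perm.SameCycle.setoid α))

/-- `α` is a pairing: every cycle of `α` has exactly two elements. -/
def IsPairing (α : Equiv.Perm (PMIdx n)) : Prop :=
  ∀ k, {l | α.SameCycle k l}.ncard = 2

end PMIdx

/-! ### Quaternionic matrices and their complex entries -/

/-- The `2 × 2` complex matrix of a quaternion `a + bi + cj + dk`, with rows and columns indexed
by `1, -1` in this order:
`[a + bi, c + di; -c + di, a - bi]`. -/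
noncomputable def quaternionRep (q : ℍ[ℝ]) : Matrix ℤˣ ℤˣ ℂ :=
  Matrix.of fun η θ =>
    if η = 1 then
      if θ = 1 then (q.re : ℂ) + q.imI * Complex.I else (q.imJ : ℂ) + q.imK * Complex.I
    else
      if θ = 1 then -(q.imJ : ℂ) + q.imK * Complex.I else (q.re : ℂ) - q.imI * Complex.I

/-- The complex entry `A_{i j; η θ}` of a quaternionic matrix. -/
noncomputable def matEntry {N : ℕ} (A : Matrix (Fin N) (Fin N) ℍ[ℝ]) (i j : Fin N) (η θ : ℤˣ) :
    ℂ :=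
  quaternionRep (A i j) η θ

/-! ### Gaussian symplectic ensemble matrices -/

/-- A standard quaternionic Gaussian random variable: its four real components are independent
`N(0, 1/4)` random variables. -/
structure IsStdQuaternionGaussian {Ω : Type*} [MeasurableSpace Ω] (P : Measure Ω)
    (q : Ω → ℍ[ℝ]) : Prop where
  re_law : HasLaw (fun ω => (q ω).re) (gaussianReal 0 (1 / 4)) P
  imI_law : HasLaw (fun ω => (q ω).imI) (gaussianReal 0 (1 / 4)) P
  imJ_law : HasLaw (fun ω => (q ω).imJ) (gaussianReal 0 (1 / 4)) P
  imK_law : HasLaw (fun ω => (q ω).imK) (gaussianReal 0 (1 / 4)) P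
  indep : iIndepFun (![fun ω => (q ω).re, fun ω => (q ω).imI, fun ω => (q ω).imJ,
    fun ω => (q ω).imK] : Fin 4 → Ω → ℝ) P

/-- An `N × N` random matrix whose entries are independent standard quaternionic Gaussian random
variables (the quaternions carry their Borel `σ`-algebra). -/
structure IsQuaternionGaussianMatrix {Ω : Type*} [MeasurableSpace Ω] (P : Measure Ω) {N : ℕ}
    (G : Ω → Matrix (Fin N) (Fin N) ℍ[ℝ]) : Prop where
  entry : ∀ i j, IsStdQuaternionGaussian P (fun ω => G ω i j)
  indep : iIndepFun (m := fun _ => borel ℍ[ℝ])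
    (fun (p : Fin N × Fin N) (ω : Ω) => G ω p.1 p.2) P

/-- A GSE matrix: `T = (G + G*) / √(2N)`, where the entries of the `N × N` matrix `G` are
independent standard quaternionic Gaussian random variables. -/
def IsGSE {Ω : Type*} [MeasurableSpace Ω] (P : Measure Ω) {N : ℕ}
    (T : Ω → Matrix (Fin N) (Fin N) ℍ[ℝ]) : Prop :=
  ∃ G : Ω → Matrix (Fin N) (Fin N) ℍ[ℝ], IsQuaternionGaussianMatrix P G ∧
    ∀ ω, T ω = (1 / √(2 * (N : ℝ))) • (G ω + (G ω)ᴴ)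

open Classical in
/-- The function `f : PM(n) → ℂ` of the GSE: `1` on pairings and `0` elsewhere. -/
noncomputable def gseWeight {n : ℕ} (α : {α : Equiv.Perm (PMIdx n) // PMIdx.IsPM α}) : ℂ :=
  if PMIdx.IsPairing α.1 then 1 else 0

open Classical in
/-- The set of `α ∈ PM(n)` with `ι = ι ∘ δα` and `sgn · η = (sgn ∘ α) · (η ∘ δα)`. -/
noncomputable def admissiblePM {n N : ℕ} (ι : PMIdx n → Fin N) (η : PMIdx n → ℤˣ) :
    Finset {α : Equiv.Perm (PMIdx n) // PMIdx.IsPM α} :=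
  {α | ι = ι ∘ (PMIdx.delta n * α.1) ∧
    PMIdx.sgn * η = (PMIdx.sgn ∘ α.1) * (η ∘ (PMIdx.delta n * α.1))}

open Classical in
/-- The sign `∏ η_k η_{-k}` over the `k ∈ [n]` with `-k ∈ FD(α)`. -/
noncomputable def fdSign {n : ℕ} (η : PMIdx n → ℤˣ) (α : Equiv.Perm (PMIdx n)) : ℤˣ :=
  ∏ k : Fin n with PMIdx.neg k ∈ PMIdx.FD α, η (PMIdx.pos k) * η (PMIdx.neg k)

/-! Every entry of `T` is a complex linear form in the 4N² independent real N(0,1/4) coordinates of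
`G`, so the moment is governed by Wick's recursion: choose one factor, pair it with each of the
others, and multiply the covariance by the moment of the remaining factors. The covariances used are
bilinear, without complex conjugation.

The quaternionic structure enters only through these covariances. For two entries with indices (i,
j; η, θ) and (i', j'; η', θ'), the covariance is 1/(2N) times the sum of two terms. One is the
indicator that the second index is the transpose of the first. The other is ηθ times the indicator
that i = i', j = j', η = -η', θ = -θ'; it comes from the relation between opposite entries of the
complex matrix of a quaternion. Each Wick edge therefore carries a sign, and the moment is a sum
over signed perfect matchings of [n] (`eq_sum_signedMatchings`, `gseCoeff_cov`).

A pairing α in PM(n) commutes with δ and never sends k to ±k. It is thus determined by k ↦ α(k) on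
[n], which is exactly a signed matching: α(k) = ±l means that k and l are joined with that sign.
Admissibility of α says that every edge has nonzero covariance. Moreover -k lies in FD(α) exactly
when α(k) = -l with l < k, so each negative edge yields one factor η_k η_{-k}, at its larger end. A
pairing has n cycles, so the power of 2N is -n/2, a factor (2N)^(-1/2) for each end of an edge
(`sum_admissiblePM_eq`, `sum_edgeWeight_mul`). -/

section GaussianMoments

/-! ### Gaussian integration by parts and Wick's recursion -/

open scoped NNReal

theorem integrable_pow_gaussianReal (v : ℝ≥0) (m : ℕ) :
    Integrable (fun x : ℝ => x ^ m) (gaussianReal 0 v) := by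
  have h := (memLp_id_gaussianReal (μ := 0) (v := v) m).integrable_norm_pow'
  refine (integrable_norm_iff (by fun_prop)).1 ?_
  simpa using h

theorem hasDerivAt_gaussianPDFReal_zero (v : ℝ≥0) (x : ℝ) :
    HasDerivAt (gaussianPDFReal 0 v) (-(x / v) * gaussianPDFReal 0 v x) x := by
  have h : HasDerivAt (fun y : ℝ => -(y - 0) ^ 2 / (2 * (v : ℝ))) (-(x / v)) x := by
    have h2 : HasDerivAt (fun y : ℝ => -(y - 0) ^ 2 / (2 * (v : ℝ)))
        (-((2 : ℕ) * (x - 0) ^ (2 - 1) * 1) / (2 * (v : ℝ))) x :=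
      ((((hasDerivAt_id x).sub_const 0).pow 2).neg).div_const _
    convert h2 using 1
    by_cases hv : (v : ℝ) = 0
    · simp [hv]
    · field_simp
      simp [mul_comm]
  have h3 := (h.exp).const_mul (√(2 * Real.pi * v))⁻¹
  rw [gaussianPDFReal_def]
  refine h3.congr_deriv ?_
  ring

/-- The integration by parts recursion for the moments of a centred Gaussian. -/
theorem integral_pow_succ_gaussianReal {v : ℝ≥0} (hv : v ≠ 0) (m : ℕ) :
    ∫ x : ℝ, x ^ (m + 1) ∂(gaussianReal 0 v) =
      v * (m * ∫ x : ℝ, x ^ (m - 1) ∂(gaussianReal 0 v)) := by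
  have hint : ∀ k : ℕ, Integrable (fun x : ℝ => x ^ k * gaussianPDFReal 0 v x) := by
    intro k
    have h := integrable_pow_gaussianReal v k
    rw [gaussianReal_of_var_ne_zero _ hv, integrable_withDensity_iff
      (measurable_gaussianPDF 0 v) (Filter.Eventually.of_forall fun _ => gaussianPDF_lt_top)] at h
    simpa using h
  have hv' : (v : ℝ) ≠ 0 := by exact_mod_cast hv
  -- The density ρ satisfies ρ' = -(x/v)ρ, so x^(m+1)ρ is -v x^m ρ'. Integrability leaves no
  -- boundary term. For m = 0 the truncated exponent m - 1 is harmless because of the factor m.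
  have key := integral_mul_deriv_eq_deriv_mul_of_integrable
    (u := fun x : ℝ => x ^ m) (u' := fun x : ℝ => m * x ^ (m - 1))
    (v := gaussianPDFReal 0 v) (v' := fun x => -(x / v) * gaussianPDFReal 0 v x)
    (fun x _ => hasDerivAt_pow m x) (fun x _ => hasDerivAt_gaussianPDFReal_zero v x)
    (by
      refine ((hint (m + 1)).const_mul (-(v : ℝ)⁻¹)).congr (Filter.Eventually.of_forall fun x => ?_)
      simp only [Pi.mul_apply]
      ring)
    (by
      refine ((hint (m - 1)).const_mul (m : ℝ)).congr (Filter.Eventually.of_forall fun x => ?_)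
      simp only [Pi.mul_apply]
      ring)
    (hint m)
  simp only [integral_gaussianReal_eq_integral_smul hv, smul_eq_mul]
  have h1 : ∀ x : ℝ, x ^ m * (-(x / v) * gaussianPDFReal 0 v x) =
      -(v : ℝ)⁻¹ * (gaussianPDFReal 0 v x * x ^ (m + 1)) := fun x => by ring
  have h2 : ∀ x : ℝ, m * x ^ (m - 1) * gaussianPDFReal 0 v x =
      m * (gaussianPDFReal 0 v x * x ^ (m - 1)) := fun x => by ring
  simp only [h1, h2, integral_const_mul] at key
  field_simp at key
  linarith

variable {J : Type*} [Fintype J]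

/-- Expectation of a complex polynomial in independent centred Gaussians of variance `v`. -/
noncomputable def gaussianExp (v : ℝ≥0) (p : MvPolynomial J ℂ) : ℂ :=
  ∫ x : J → ℝ, MvPolynomial.eval (fun j => (x j : ℂ)) p ∂(Measure.pi fun _ => gaussianReal 0 v)

theorem integrable_eval_gaussian (v : ℝ≥0) (p : MvPolynomial J ℂ) :
    Integrable (fun x : J → ℝ => MvPolynomial.eval (fun j => (x j : ℂ)) p)
      (Measure.pi fun _ => gaussianReal 0 v) := by
  induction p using MvPolynomial.induction_on' with
  | monomial m a =>
    simp only [MvPolynomial.eval_monomial, Finsupp.prod_fintype, pow_zero, implies_true]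
    refine Integrable.const_mul ?_ a
    refine Integrable.fintype_prod (f := fun j (y : ℝ) => (y : ℂ) ^ m j) fun j => ?_
    simpa using (integrable_pow_gaussianReal v (m j)).ofReal (𝕜 := ℂ)
  | add p q hp hq =>
    simp only [map_add]
    exact hp.add hq

theorem gaussianExp_add (v : ℝ≥0) (p q : MvPolynomial J ℂ) :
    gaussianExp v (p + q) = gaussianExp v p + gaussianExp v q := by
  simp only [gaussianExp, map_add]
  exact integral_add (integrable_eval_gaussian v p) (integrable_eval_gaussian v q)

theorem gaussianExp_C_mul (v : ℝ≥0) (c : ℂ) (p : MvPolynomial J ℂ) :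
    gaussianExp v (MvPolynomial.C c * p) = c * gaussianExp v p := by
  simp only [gaussianExp, map_mul, MvPolynomial.eval_C]
  exact integral_const_mul _ _

theorem gaussianExp_zero (v : ℝ≥0) : gaussianExp v (0 : MvPolynomial J ℂ) = 0 := by
  simp [gaussianExp]

theorem gaussianExp_one (v : ℝ≥0) : gaussianExp v (1 : MvPolynomial J ℂ) = 1 := by
  simp [gaussianExp]

theorem gaussianExp_sum (v : ℝ≥0) {K : Type*} (s : Finset K) (f : K → MvPolynomial J ℂ) :
    gaussianExp v (∑ k ∈ s, f k) = ∑ k ∈ s, gaussianExp v (f k) := by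
  classical
  induction s using Finset.induction_on with
  | empty => simp [gaussianExp_zero]
  | insert k s hk ih => rw [Finset.sum_insert hk, Finset.sum_insert hk, gaussianExp_add, ih]

theorem gaussianExp_monomial (v : ℝ≥0) (m : J →₀ ℕ) (a : ℂ) :
    gaussianExp v (MvPolynomial.monomial m a) =
      a * ∏ j, ((∫ x : ℝ, x ^ m j ∂(gaussianReal 0 v) : ℝ) : ℂ) := by
  simp only [gaussianExp, MvPolynomial.eval_monomial, Finsupp.prod_fintype, pow_zero, implies_true]
  rw [integral_const_mul, integral_fintype_prod_eq_prod (f := fun j (y : ℝ) => (y : ℂ) ^ m j)]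
  congr 1
  refine Finset.prod_congr rfl fun j _ => ?_
  rw [← integral_complex_ofReal]
  simp

/-- Gaussian integration by parts for polynomials. -/
theorem gaussianExp_X_mul {v : ℝ≥0} (hv : v ≠ 0) (j : J) (p : MvPolynomial J ℂ) :
    gaussianExp v (MvPolynomial.X j * p) = v * gaussianExp v (MvPolynomial.pderiv j p) := by
  classical
  induction p using MvPolynomial.induction_on' with
  | monomial m a =>
    rw [MvPolynomial.pderiv_monomial, MvPolynomial.X, MvPolynomial.monomial_mul,
      gaussianExp_monomial, gaussianExp_monomial, one_mul,
      ← Finset.mul_prod_erase _ _ (Finset.mem_univ j),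
      ← Finset.mul_prod_erase _ _ (Finset.mem_univ j)]
    -- Away from j the two monomials have the same exponents; at j the claim is the one-variable
    -- recursion.
    have h : ∀ i ∈ Finset.univ.erase j, (Finsupp.single j 1 + m : J →₀ ℕ) i =
        (m - Finsupp.single j 1 : J →₀ ℕ) i :=
      fun i hi => by simp [(Finset.ne_of_mem_erase hi).symm]
    rw [Finset.prod_congr rfl fun i hi => by rw [h i hi]]
    simp only [Finsupp.add_apply, Finsupp.single_eq_same, Finsupp.tsub_apply]
    rw [add_comm 1, integral_pow_succ_gaussianReal hv]
    push_cast
    ring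
  | add p q hp hq => rw [mul_add, gaussianExp_add, hp, hq, map_add, gaussianExp_add, mul_add]

/-- The linear form with coefficients `c`. -/
noncomputable def linForm (c : J → ℂ) : MvPolynomial J ℂ :=
  ∑ j, MvPolynomial.C (c j) * MvPolynomial.X j

theorem pderiv_linForm (c : J → ℂ) (j : J) :
    MvPolynomial.pderiv j (linForm c) = MvPolynomial.C (c j) := by
  classical
  simp [linForm, MvPolynomial.pderiv_X, Pi.single_apply]

theorem derivation_prod {R A K : Type*} [CommSemiring R] [CommSemiring A] [Algebra R A]
    [DecidableEq K] (D : Derivation R A A) (s : Finset K) (f : K → A) :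
    D (∏ k ∈ s, f k) = ∑ k ∈ s, D (f k) * ∏ l ∈ s.erase k, f l := by
  induction s using Finset.induction_on with
  | empty => simp
  | insert a s ha ih =>
    rw [Finset.prod_insert ha, Derivation.leibniz, ih, Finset.sum_insert ha,
      Finset.erase_insert ha, smul_eq_mul, smul_eq_mul, add_comm, mul_comm (∏ k ∈ s, f k)]
    congr 1
    rw [Finset.mul_sum]
    refine Finset.sum_congr rfl fun k hk => ?_
    have hka : k ≠ a := fun h => ha (h ▸ hk)
    rw [Finset.erase_insert_of_ne hka.symm, Finset.prod_insert (by simp [ha])]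
    ring

/-- The recursive form of Wick's formula. -/
theorem gaussianExp_prod_linForm {v : ℝ≥0} (hv : v ≠ 0) {K : Type*} [DecidableEq K]
    (c : K → J → ℂ) {S : Finset K} {m : K} (hm : m ∈ S) :
    gaussianExp v (∏ k ∈ S, linForm (c k)) =
      ∑ l ∈ S.erase m, (v * ∑ j, c m j * c l j) *
        gaussianExp v (∏ k ∈ (S.erase m).erase l, linForm (c k)) := by
  rw [← Finset.mul_prod_erase _ _ hm]
  -- Only the form at `m` is expanded: each of its variables becomes a derivative that falls on one
  -- other factor, whose derivative is a constant.
  nth_rw 1 [linForm]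
  rw [Finset.sum_mul, gaussianExp_sum]
  simp_rw [mul_assoc, gaussianExp_C_mul, gaussianExp_X_mul hv, derivation_prod, pderiv_linForm,
    gaussianExp_sum, gaussianExp_C_mul, Finset.mul_sum, Finset.sum_mul, Finset.mul_sum]
  rw [Finset.sum_comm]
  refine Finset.sum_congr rfl fun l _ => Finset.sum_congr rfl fun j _ => ?_
  ring

end GaussianMoments

/-! ### Signed perfect matchings and their recursion -/

section SignedMatchings

variable {V : Type*} [Fintype V] [DecidableEq V]

/-- Perfect matchings of `S` whose edges carry a sign, encoded by the map that sends a vertex to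
its partner and the sign of the edge; off `S` the map is trivial. -/
def signedMatchings (S : Finset V) : Finset (V → V × ℤˣ) :=
  {β | (∀ k, β (β k).1 = (k, (β k).2)) ∧ (∀ k, k ∉ S → β k = (k, 1)) ∧ ∀ k ∈ S, (β k).1 ≠ k}

theorem mem_signedMatchings {S : Finset V} {β : V → V × ℤˣ} :
    β ∈ signedMatchings S ↔ (∀ k, β (β k).1 = (k, (β k).2)) ∧ (∀ k, k ∉ S → β k = (k, 1)) ∧
      ∀ k ∈ S, (β k).1 ≠ k := by
  simp [signedMatchings]

theorem apply_mem_of_mem_signedMatchings {S : Finset V} {β : V → V × ℤˣ}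
    (h : β ∈ signedMatchings S) {k : V} (hk : k ∈ S) : (β k).1 ∈ S.erase k := by
  rw [mem_signedMatchings] at h
  obtain ⟨h1, h2, h3⟩ := h
  refine Finset.mem_erase.2 ⟨h3 k hk, ?_⟩
  -- A partner outside `S` would be fixed, and symmetry of the edge would then make it equal to `k`.
  by_contra hn
  have h4 := h2 _ hn
  rw [h1 k, Prod.mk.injEq] at h4
  exact h3 k hk h4.1.symm

theorem remove_edge_mem_signedMatchings {S : Finset V} {β : V → V × ℤˣ}
    (h : β ∈ signedMatchings S) {m l : V} {s : ℤˣ} (hm : m ∈ S) (hl : β m = (l, s)) :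
    Function.update (Function.update β m (m, 1)) l (l, 1) ∈
      signedMatchings ((S.erase m).erase l) := by
  have hlm : l ≠ m := by
    have := Finset.ne_of_mem_erase (apply_mem_of_mem_signedMatchings h hm)
    rwa [hl] at this
  rw [mem_signedMatchings] at h ⊢
  obtain ⟨h1, h2, h3⟩ := h
  have hlm' : β l = (m, s) := by simpa [hl] using h1 m
  refine ⟨fun k => ?_, fun k hk => ?_, fun k hk => ?_⟩
  · by_cases hkl : k = l
    · subst hkl; simp
    by_cases hkm : k = m
    · subst hkm; simp [Function.update_of_ne hkl]
    have a1 : (β k).1 ≠ l := by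
      intro h
      have := h1 k
      rw [h, hlm', Prod.mk.injEq] at this
      exact hkm this.1.symm
    have a2 : (β k).1 ≠ m := by
      intro h
      have := h1 k
      rw [h, hl, Prod.mk.injEq] at this
      exact hkl this.1.symm
    rw [Function.update_of_ne hkl, Function.update_of_ne hkm, Function.update_of_ne a1,
      Function.update_of_ne a2, h1]
  · by_cases hkl : k = l
    · subst hkl; simp
    by_cases hkm : k = m
    · subst hkm; simp [Function.update_of_ne hkl]
    rw [Function.update_of_ne hkl, Function.update_of_ne hkm]
    exact h2 k fun hS => hk (by simp [hkl, hkm, hS])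
  · simp only [Finset.mem_erase] at hk
    rw [Function.update_of_ne hk.1, Function.update_of_ne hk.2.1]
    exact h3 k hk.2.2

theorem add_edge_mem_signedMatchings {S : Finset V} {β : V → V × ℤˣ} {m l : V} (s : ℤˣ)
    (hm : m ∈ S) (hl : l ∈ S.erase m) (h : β ∈ signedMatchings ((S.erase m).erase l)) :
    Function.update (Function.update β m (l, s)) l (m, s) ∈ signedMatchings S := by
  have hlm : l ≠ m := Finset.ne_of_mem_erase hl
  have hlS : l ∈ S := Finset.mem_of_mem_erase hl
  rw [mem_signedMatchings] at h ⊢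
  obtain ⟨h1, h2, h3⟩ := h
  have b1 : β m = (m, 1) := h2 m (by simp)
  have b2 : β l = (l, 1) := h2 l (by simp)
  refine ⟨fun k => ?_, fun k hk => ?_, fun k hk => ?_⟩
  · by_cases hkl : k = l
    · subst hkl; simp [Function.update_of_ne hlm.symm]
    by_cases hkm : k = m
    · subst hkm; simp [Function.update_of_ne hkl]
    have a1 : (β k).1 ≠ l := by
      intro h
      have := h1 k
      rw [h, b2, Prod.mk.injEq] at this
      exact hkl this.1.symm
    have a2 : (β k).1 ≠ m := by
      intro h
      have := h1 k
      rw [h, b1, Prod.mk.injEq] at this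
      exact hkm this.1.symm
    rw [Function.update_of_ne hkl, Function.update_of_ne hkm, Function.update_of_ne a1,
      Function.update_of_ne a2, h1]
  · have hkl : k ≠ l := fun e => hk (e ▸ hlS)
    have hkm : k ≠ m := fun e => hk (e ▸ hm)
    rw [Function.update_of_ne hkl, Function.update_of_ne hkm]
    exact h2 k fun hS => hk (Finset.mem_of_mem_erase (Finset.mem_of_mem_erase hS))
  · by_cases hkl : k = l
    · subst hkl; simpa using hlm.symm
    by_cases hkm : k = m
    · subst hkm; simpa [Function.update_of_ne hkl] using hlm
    rw [Function.update_of_ne hkl, Function.update_of_ne hkm]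
    exact h3 k (by simp [hkl, hkm, hk])

/-- Expansion of a sum over signed matchings along the edge at a given vertex. -/
theorem sum_signedMatchings_eq {R : Type*} [CommSemiring R] (φ : V → V × ℤˣ → R) {S : Finset V}
    {m : V} (hm : m ∈ S) :
    ∑ β ∈ signedMatchings S, ∏ k ∈ S, φ k (β k) =
      ∑ l ∈ S.erase m, (∑ s : ℤˣ, φ m (l, s) * φ l (m, s)) *
        ∑ β ∈ signedMatchings ((S.erase m).erase l), ∏ k ∈ (S.erase m).erase l, φ k (β k) := by
  rw [← Finset.sum_fiberwise_of_maps_to (g := fun β : V → V × ℤˣ => β m)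
    (t := S.erase m ×ˢ Finset.univ)
    (fun β hβ => Finset.mem_product.2 ⟨apply_mem_of_mem_signedMatchings hβ hm, Finset.mem_univ _⟩),
    Finset.sum_product]
  refine Finset.sum_congr rfl fun l hl => ?_
  rw [Finset.sum_mul]
  refine Finset.sum_congr rfl fun s _ => ?_
  rw [Finset.mul_sum]
  have hlm : l ≠ m := Finset.ne_of_mem_erase hl
  -- On the fibre where `m` is joined to `l` with sign `s`, deleting this edge and restoring it are
  -- mutually inverse. Triviality off the vertex set makes the restored values unambiguous.
  refine Finset.sum_nbij' (fun β => Function.update (Function.update β m (m, 1)) l (l, 1))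
    (fun β => Function.update (Function.update β m (l, s)) l (m, s)) ?_ ?_ ?_ ?_ ?_
  · intro β hβ
    rw [Finset.mem_filter] at hβ
    exact remove_edge_mem_signedMatchings hβ.1 hm hβ.2
  · intro β hβ
    rw [Finset.mem_filter]
    exact ⟨add_edge_mem_signedMatchings s hm hl hβ, by simp [Function.update_of_ne hlm.symm]⟩
  · intro β hβ
    rw [Finset.mem_filter, mem_signedMatchings] at hβ
    obtain ⟨⟨h1, -⟩, h⟩ := hβ
    have h' : β l = (m, s) := by simpa [h] using h1 m
    ext1 k
    by_cases hkl : k = l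
    · subst hkl; simp [h']
    by_cases hkm : k = m
    · subst hkm; simp [Function.update_of_ne hkl, h]
    simp [Function.update_of_ne hkl, Function.update_of_ne hkm]
  · intro β hβ
    rw [mem_signedMatchings] at hβ
    have b1 : β m = (m, 1) := hβ.2.1 m (by simp)
    have b2 : β l = (l, 1) := hβ.2.1 l (by simp)
    ext1 k
    by_cases hkl : k = l
    · subst hkl; simp [b2]
    by_cases hkm : k = m
    · subst hkm; simp [Function.update_of_ne hkl, b1]
    simp [Function.update_of_ne hkl, Function.update_of_ne hkm]
  · intro β hβ
    rw [Finset.mem_filter, mem_signedMatchings] at hβ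
    obtain ⟨⟨h1, -⟩, h⟩ := hβ
    have h' : β l = (m, s) := by simpa [h] using h1 m
    rw [← Finset.mul_prod_erase _ _ hm, ← Finset.mul_prod_erase _ _ hl, h, h', mul_assoc]
    congr 2
    refine Finset.prod_congr rfl fun k hk => ?_
    simp only [Finset.mem_erase] at hk
    rw [Function.update_of_ne hk.1, Function.update_of_ne hk.2.1]

/-- A functional on finite sets that satisfies Wick's recursion is the sum over signed
matchings. -/
theorem eq_sum_signedMatchings {R : Type*} [CommSemiring R] (φ : V → V × ℤˣ → R)
    (M : Finset V → R) (h0 : M ∅ = 1)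
    (hM : ∀ S : Finset V, ∀ m ∈ S, M S = ∑ l ∈ S.erase m,
      (∑ s : ℤˣ, φ m (l, s) * φ l (m, s)) * M ((S.erase m).erase l)) (S : Finset V) :
    M S = ∑ β ∈ signedMatchings S, ∏ k ∈ S, φ k (β k) := by
  induction S using Finset.strongInduction with
  | H S ih =>
    rcases S.eq_empty_or_nonempty with rfl | ⟨m, hm⟩
    · have : signedMatchings (∅ : Finset V) = {fun k => (k, 1)} := by
        ext β
        rw [mem_signedMatchings, Finset.mem_singleton]
        constructor
        · rintro ⟨-, h, -⟩
          ext1 k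
          exact h k (by simp)
        · rintro rfl
          simp
      simp [h0, this]
    · rw [hM S m hm, sum_signedMatchings_eq φ hm]
      refine Finset.sum_congr rfl fun l _ => ?_
      rw [ih _ (lt_of_le_of_lt (Finset.erase_subset _ _) (Finset.erase_ssubset hm))]

end SignedMatchings

/-! ### Entries as linear forms and their covariances -/

section Quaternions

open scoped NNReal

/-- The four real coordinates of a quaternion. -/
def quatCoord (q : ℍ[ℝ]) : Fin 4 → ℝ := ![q.re, q.imI, q.imJ, q.imK]

/-- The coefficients of an entry of `quaternionRep` in the real coordinates. -/
noncomputable def repCoeff (η θ : ℤˣ) : Fin 4 → ℂ :=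
  if η = 1 then
    if θ = 1 then ![1, Complex.I, 0, 0] else ![0, 0, 1, Complex.I]
  else
    if θ = 1 then ![0, 0, -1, Complex.I] else ![1, -Complex.I, 0, 0]

/-- The signs by which conjugation acts on the coordinates of a quaternion. -/
def conjSign : Fin 4 → ℂ := ![1, -1, -1, -1]

theorem quaternionRep_eq_sum (q : ℍ[ℝ]) (η θ : ℤˣ) :
    quaternionRep q η θ = ∑ a, repCoeff η θ a * quatCoord q a := by
  unfold quaternionRep repCoeff quatCoord
  rw [Matrix.of_apply]
  split_ifs <;> simp [Fin.sum_univ_four] <;> ring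

theorem quatCoord_star (q : ℍ[ℝ]) (a : Fin 4) :
    (quatCoord (star q) a : ℂ) = conjSign a * quatCoord q a := by
  fin_cases a <;> simp [quatCoord, conjSign]

/-- In the matrix of a quaternion, the entry at (-η, -θ) is ηθ times the complex conjugate of the
entry at (η, θ). This is the source of the sign in the covariance. -/
theorem sum_repCoeff_mul (η θ η' θ' : ℤˣ) :
    ∑ a, repCoeff η θ a * repCoeff η' θ' a =
      if η = -η' ∧ θ = -θ' then 2 * (((η * θ : ℤˣ) : ℤ) : ℂ) else 0 := by
  rcases Int.units_eq_one_or η with rfl | rfl <;> rcases Int.units_eq_one_or θ with rfl | rfl <;>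
  rcases Int.units_eq_one_or η' with rfl | rfl <;> rcases Int.units_eq_one_or θ' with rfl | rfl <;>
  simp [repCoeff, Fin.sum_univ_four] <;> norm_num

/-- The conjugate quaternion is represented by the conjugate transpose, so its (η, θ) entry
correlates with the (θ, η) entry of the original quaternion, without a sign. -/
theorem sum_conjSign_mul_repCoeff_mul (η θ η' θ' : ℤˣ) :
    ∑ a, conjSign a * repCoeff η θ a * repCoeff η' θ' a =
      if η = θ' ∧ θ = η' then 2 else 0 := by
  rcases Int.units_eq_one_or η with rfl | rfl <;> rcases Int.units_eq_one_or θ with rfl | rfl <;>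
  rcases Int.units_eq_one_or η' with rfl | rfl <;> rcases Int.units_eq_one_or θ' with rfl | rfl <;>
  simp [repCoeff, conjSign, Fin.sum_univ_four] <;> norm_num

theorem conjSign_mul_self (a : Fin 4) : conjSign a * conjSign a = 1 := by
  fin_cases a <;> simp [conjSign]

/-- The coefficients of an entry of a GSE matrix in the coordinates of the Gaussian matrix. -/
noncomputable def gseCoeff {N : ℕ} (i j : Fin N) (η θ : ℤˣ) : (Fin N × Fin N) × Fin 4 → ℂ :=
  fun x => ((1 / √(2 * (N : ℝ)) : ℝ) : ℂ) * ((if x.1 = (i, j) then repCoeff η θ x.2 else 0) +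
    if x.1 = (j, i) then conjSign x.2 * repCoeff η θ x.2 else 0)

theorem eval_linForm {J : Type*} [Fintype J] (x : J → ℂ) (c : J → ℂ) :
    MvPolynomial.eval x (linForm c) = ∑ j, c j * x j := by
  simp [linForm]

/-- The indicators leave only the blocks (i, j) and (j, i). For i = j the blocks coincide and their
contributions add, so the diagonal needs no separate case. -/
theorem sum_gseCoeff_mul {N : ℕ} (i j : Fin N) (η θ : ℤˣ) (f : (Fin N × Fin N) × Fin 4 → ℂ) :
    ∑ x, gseCoeff i j η θ x * f x = ((1 / √(2 * (N : ℝ)) : ℝ) : ℂ) *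
      ((∑ a, repCoeff η θ a * f ((i, j), a)) +
        ∑ a, conjSign a * repCoeff η θ a * f ((j, i), a)) := by
  simp only [gseCoeff, mul_assoc, ← Finset.mul_sum]
  congr 1
  rw [Fintype.sum_prod_type, Finset.sum_comm, ← Finset.sum_add_distrib]
  refine Finset.sum_congr rfl fun a _ => ?_
  simp [add_mul, Finset.sum_add_distrib, ite_mul, mul_assoc]

theorem matEntry_gse {N : ℕ} (G : Matrix (Fin N) (Fin N) ℍ[ℝ]) (i j : Fin N) (η θ : ℤˣ) :
    matEntry ((1 / √(2 * (N : ℝ))) • (G + Gᴴ)) i j η θ =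
      MvPolynomial.eval (fun x : (Fin N × Fin N) × Fin 4 => (quatCoord (G x.1.1 x.1.2) x.2 : ℂ))
        (linForm (gseCoeff i j η θ)) := by
  rw [eval_linForm, sum_gseCoeff_mul, matEntry, quaternionRep_eq_sum]
  rw [← Finset.sum_add_distrib, Finset.mul_sum]
  refine Finset.sum_congr rfl fun a _ => ?_
  have h : (quatCoord (((1 / √(2 * (N : ℝ))) • (G + Gᴴ)) i j) a : ℂ) =
      ((1 / √(2 * (N : ℝ)) : ℝ) : ℂ) * (quatCoord (G i j) a + quatCoord (star (G j i)) a) := by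
    rw [Matrix.smul_apply, Matrix.add_apply, Matrix.conjTranspose_apply]
    fin_cases a <;> simp [quatCoord] <;> ring
  rw [h, quatCoord_star]
  ring

/-- The covariance of two entries of a GSE matrix. -/
theorem gseCoeff_cov {N : ℕ} (i j i' j' : Fin N) (η θ η' θ' : ℤˣ) :
    (((1 / 4 : ℝ≥0) : ℝ) : ℂ) * ∑ x, gseCoeff i j η θ x * gseCoeff i' j' η' θ' x =
      ((1 / √(2 * (N : ℝ)) : ℝ) : ℂ) ^ 2 *
        ((if i = j' ∧ j = i' ∧ η = θ' ∧ θ = η' then 1 else 0) +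
          if i = i' ∧ j = j' ∧ η = -η' ∧ θ = -θ' then (((η * θ : ℤˣ) : ℤ) : ℂ) else 0) := by
  rw [sum_gseCoeff_mul]
  have h1 : ∑ a, repCoeff η θ a * gseCoeff i' j' η' θ' ((i, j), a) =
      ((1 / √(2 * (N : ℝ)) : ℝ) : ℂ) *
      ((if i = i' ∧ j = j' then ∑ a, repCoeff η θ a * repCoeff η' θ' a else 0) +
        if i = j' ∧ j = i' then ∑ a, conjSign a * repCoeff η θ a * repCoeff η' θ' a else 0) := by
    simp only [gseCoeff, Prod.mk.injEq]
    split_ifs <;> simp only [← Finset.sum_add_distrib, Finset.mul_sum, add_zero, zero_add,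
      mul_zero, Finset.sum_const_zero] <;>
    exact Finset.sum_congr rfl fun a _ => by ring
  have h2 : ∑ a, conjSign a * repCoeff η θ a * gseCoeff i' j' η' θ' ((j, i), a) =
      ((1 / √(2 * (N : ℝ)) : ℝ) : ℂ) *
      ((if i = i' ∧ j = j' then ∑ a, repCoeff η θ a * repCoeff η' θ' a else 0) +
        if i = j' ∧ j = i' then ∑ a, conjSign a * repCoeff η θ a * repCoeff η' θ' a else 0) := by
    simp only [gseCoeff, Prod.mk.injEq, and_comm (a := j = j'), and_comm (a := j = i')]
    split_ifs <;> simp only [← Finset.sum_add_distrib, Finset.mul_sum, add_zero, zero_add,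
      mul_zero, Finset.sum_const_zero] <;>
    refine Finset.sum_congr rfl fun a _ => ?_
    -- Where conjugation acts on both factors, its signs cancel.
    all_goals first
      | ring1
      | linear_combination ((1 / √(2 * (N : ℝ)) : ℝ) * repCoeff η θ a * repCoeff η' θ' a : ℂ) *
          conjSign_mul_self a
  -- The blocks (i, j) and (j, i) contribute equally; this factor 2 and the 2 of the coefficient
  -- sums cancel the variance 1/4.
  rw [h1, h2, sum_repCoeff_mul, sum_conjSign_mul_repCoeff_mul]
  have e1 : (i = j' ∧ j = i' ∧ η = θ' ∧ θ = η') ↔ (i = j' ∧ j = i') ∧ (η = θ' ∧ θ = η') := by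
    tauto
  have e2 : (i = i' ∧ j = j' ∧ η = -η' ∧ θ = -θ') ↔ (i = i' ∧ j = j') ∧ (η = -η' ∧ θ = -θ') := by
    tauto
  simp only [e1, e2, ite_and]
  push_cast
  split_ifs <;> ring

end Quaternions

/-! ### Joint law of the coordinates of the Gaussian matrix -/

section Law

open scoped NNReal

variable {Ω : Type*} [MeasurableSpace Ω] {P : Measure Ω}

theorem measurable_quatCoord (a : Fin 4) :
    @Measurable _ _ (borel ℍ[ℝ]) _ fun q : ℍ[ℝ] => quatCoord q a := by
  borelize ℍ[ℝ]
  refine Continuous.measurable ?_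
  fin_cases a
  · exact Quaternion.continuous_re
  · exact Quaternion.continuous_imI
  · exact Quaternion.continuous_imJ
  · exact Quaternion.continuous_imK

theorem IsStdQuaternionGaussian.hasLaw_quatCoord {q : Ω → ℍ[ℝ]}
    (h : IsStdQuaternionGaussian P q) (a : Fin 4) :
    HasLaw (fun ω => quatCoord (q ω) a) (gaussianReal 0 (1 / 4)) P := by
  fin_cases a
  · exact h.re_law
  · exact h.imI_law
  · exact h.imJ_law
  · exact h.imK_law

theorem IsStdQuaternionGaussian.iIndepFun_quatCoord {q : Ω → ℍ[ℝ]}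
    (h : IsStdQuaternionGaussian P q) : iIndepFun (fun a ω => quatCoord (q ω) a) P := by
  convert h.indep using 2 with a
  fin_cases a <;> rfl

/-- Independence of blocks and within blocks yields joint independence, for a countable family
of almost everywhere measurable functions. -/
theorem iIndepFun_uncurry_of_aemeasurable {I K 𝓧 : Type*} [Countable K] [MeasurableSpace 𝓧]
    {X : I → K → Ω → 𝓧} (mX : ∀ i j, AEMeasurable (X i j) P)
    (h1 : iIndepFun (fun i ω => fun j => X i j ω) P) (h2 : ∀ i, iIndepFun (X i) P) :
    iIndepFun (fun (p : I × K) ω => X p.1 p.2 ω) P := by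
  -- Measurable modifications suffice, since independence is unaffected by changes on null sets.
  have h := iIndepFun_uncurry' (P := P) (X := fun i j => (mX i j).mk (X i j))
    (fun i j => (mX i j).measurable_mk)
    (h1.congr fun i => by
      filter_upwards [ae_all_iff.2 fun j => (mX i j).ae_eq_mk] with ω hω
      exact funext hω)
    (fun i => (h2 i).congr fun j => (mX i j).ae_eq_mk)
  exact h.congr fun p => (mX p.1 p.2).ae_eq_mk.symm

/-- The joint law of the coordinates of a quaternionic Gaussian matrix. -/
theorem IsQuaternionGaussianMatrix.hasLaw [IsProbabilityMeasure P] {N : ℕ}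
    {G : Ω → Matrix (Fin N) (Fin N) ℍ[ℝ]} (h : IsQuaternionGaussianMatrix P G) :
    HasLaw (fun ω (x : (Fin N × Fin N) × Fin 4) => quatCoord (G ω x.1.1 x.1.2) x.2)
      (Measure.pi fun _ => gaussianReal 0 (1 / 4)) P := by
  have hl := fun x : (Fin N × Fin N) × Fin 4 => (h.entry x.1.1 x.1.2).hasLaw_quatCoord x.2
  refine iIndepFun.hasLaw_pi hl ?_
  refine iIndepFun_uncurry_of_aemeasurable
    (X := fun (p : Fin N × Fin N) (a : Fin 4) ω => quatCoord (G ω p.1 p.2) a)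
    (fun p a => (hl (p, a)).aemeasurable) ?_ fun p => (h.entry p.1 p.2).iIndepFun_quatCoord
  let : MeasurableSpace ℍ[ℝ] := borel ℍ[ℝ]
  exact h.indep.comp (fun _ q a => quatCoord q a)
    fun _ => measurable_pi_iff.2 measurable_quatCoord

/-- Expectations of products of entries of a GSE matrix as Gaussian expectations. -/
theorem IsGSE.integrable_and_integral [IsProbabilityMeasure P] {N : ℕ}
    {T : Ω → Matrix (Fin N) (Fin N) ℍ[ℝ]} (hT : IsGSE P T) {K : Type*} (S : Finset K)
    (i j : K → Fin N) (η θ : K → ℤˣ) :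
    Integrable (fun ω => ∏ k ∈ S, matEntry (T ω) (i k) (j k) (η k) (θ k)) P ∧
    ∫ ω, ∏ k ∈ S, matEntry (T ω) (i k) (j k) (η k) (θ k) ∂P =
      gaussianExp (1 / 4) (∏ k ∈ S, linForm (gseCoeff (i k) (j k) (η k) (θ k))) := by
  obtain ⟨G, hG, hTG⟩ := hT
  have hlaw := hG.hasLaw
  simp only [hTG, matEntry_gse, ← map_prod]
  have hint := integrable_eval_gaussian (1 / 4)
    (∏ k ∈ S, linForm (gseCoeff (i k) (j k) (η k) (θ k)))
  constructor
  · rw [← hlaw.map_eq] at hint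
    exact hint.comp_aemeasurable hlaw.aemeasurable
  · exact hlaw.integral_comp hint.aestronglyMeasurable

end Law

/-! ### Pairings in PM(n) as signed matchings -/

namespace PMIdx

variable {n : ℕ} {α : Equiv.Perm (PMIdx n)}

theorem sameCycle_iff_of_involutive (h : Function.Involutive α) {k l : PMIdx n} :
    α.SameCycle k l ↔ l = k ∨ l = α k := by
  have h2 : α ^ (2 : ℤ) = 1 := by
    ext1 x
    rw [zpow_ofNat, pow_two, Equiv.Perm.mul_apply, h x, Equiv.Perm.one_apply]
  constructor
  · rintro ⟨i, rfl⟩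
    rcases Int.even_or_odd' i with ⟨c, rfl | rfl⟩
    · left; rw [zpow_mul, h2, one_zpow, Equiv.Perm.one_apply]
    · right; rw [zpow_add, zpow_mul, h2, one_zpow, one_mul, zpow_one]
  · rintro (rfl | rfl)
    · exact Equiv.Perm.SameCycle.refl _ _
    · exact ⟨1, by simp⟩

theorem IsPairing.apply_ne (h : IsPairing α) (k : PMIdx n) : α k ≠ k := by
  intro hk
  have : {l | α.SameCycle k l} = {k} := by
    ext l
    simp only [Set.mem_ofPred_eq, Set.mem_singleton_iff]
    constructor
    · rintro ⟨i, rfl⟩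
      exact Function.IsFixedPt.perm_zpow hk i
    · rintro rfl
      exact Equiv.Perm.SameCycle.refl _ _
  have h2 := h k
  rw [this, Set.ncard_singleton] at h2
  omega

/-- The two distinct elements k and α(k) fill the cycle, which also contains α(α(k)); the latter
cannot be α(k), so it is k. -/
theorem IsPairing.involutive (h : IsPairing α) : Function.Involutive α := by
  intro k
  have hsub : ({k, α k} : Set (PMIdx n)) ⊆ {l | α.SameCycle k l} := by
    rintro l (rfl | rfl)
    · exact Equiv.Perm.SameCycle.refl _ _
    · exact ⟨1, by simp⟩
  have heq := Set.eq_of_subset_of_ncard_le hsub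
    (by rw [h k, Set.ncard_pair (h.apply_ne k).symm]) (Set.toFinite _)
  have hmem : α (α k) ∈ ({k, α k} : Set (PMIdx n)) := by
    rw [heq]
    exact ⟨2, by rw [zpow_ofNat, pow_two, Equiv.Perm.mul_apply]⟩
  rcases hmem with h1 | h1
  · exact h1
  · exact absurd h1 (h.apply_ne _)

theorem isPairing_of_involutive (h : Function.Involutive α) (hne : ∀ k, α k ≠ k) :
    IsPairing α := by
  intro k
  have : {l | α.SameCycle k l} = {k, α k} := by
    ext l
    simp [sameCycle_iff_of_involutive h]
  rw [this, Set.ncard_pair (hne k).symm]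

theorem IsPairing.numCycles_eq (h : IsPairing α) : numCycles α = n := by
  classical
  have hcard : Fintype.card (PMIdx n) = Fintype.card (Quotient (Equiv.Perm.SameCycle.setoid α)) * 2 := by
    rw [← Finset.card_univ, ← Finset.card_univ, Finset.card_eq_sum_card_fiberwise
      (f := Quotient.mk (Equiv.Perm.SameCycle.setoid α)) (t := Finset.univ) (by simp)]
    refine Finset.sum_const_nat fun q _ => ?_
    induction q using Quotient.inductionOn with
    | h k =>
      rw [← h k, ← Set.ncard_coe_finset]
      congr 1
      ext l
      simp only [Finset.coe_filter, Finset.mem_univ, true_and, Set.mem_ofPred_eq]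
      rw [Quotient.eq]
      exact Equiv.Perm.sameCycle_comm
  rw [numCycles, Nat.card_eq_fintype_card]
  simp [PMIdx, Fintype.card_prod] at hcard
  omega

theorem IsPM.apply_delta (h : IsPM α) (hi : Function.Involutive α) (k : PMIdx n) :
    α (delta n k) = delta n (α k) := by
  have h1 : delta n (α (delta n k)) = α⁻¹ k := by
    rw [← h.1]
    rfl
  have h2 : α⁻¹ k = α k := by
    rw [Equiv.Perm.inv_eq_iff_eq, hi k]
  rw [h2] at h1
  rw [← h1]
  simp [delta]

/-- An involution in PM(n) commutes with δ, so its values on [n] determine it. -/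
theorem IsPM.apply_eq (h : IsPM α) (hi : Function.Involutive α) (k : PMIdx n) :
    α k = ((α (k.1, 1)).1, (α (k.1, 1)).2 * k.2) := by
  obtain ⟨k, s⟩ := k
  rcases Int.units_eq_one_or s with rfl | rfl
  · simp
  · simpa [delta] using h.apply_delta hi (k, 1)

/-- A pairing excludes α(k) = k, and separation of the cycles of k and -k excludes α(k) = -k. -/
theorem IsPM.apply_fst_ne (h : IsPM α) (hp : IsPairing α) (k : Fin n) : (α (k, 1)).1 ≠ k := by
  intro hk
  rcases Int.units_eq_one_or (α (k, 1)).2 with h1 | h1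
  · exact hp.apply_ne (k, 1) (Prod.ext hk h1)
  · refine h.2 (k, 1) ⟨1, ?_⟩
    rw [zpow_one]
    exact Prod.ext hk h1

/-- The cycle of -k is {-k, -α(k)}. Its element of smallest absolute value is positive only if it is
-α(k), and the absolute values differ. -/
theorem IsPM.neg_mem_FD_iff (h : IsPM α) (hp : IsPairing α) (k : Fin n) :
    neg k ∈ FD α ↔ (α (k, 1)).1 < k ∧ (α (k, 1)).2 = -1 := by
  have hne := h.apply_fst_ne hp k
  have h1 := h.apply_eq hp.involutive (k, -1)
  simp only [FD, neg, Set.mem_ofPred_eq, sameCycle_iff_of_involutive hp.involutive, h1]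
  constructor
  · rintro ⟨m, rfl | rfl, hm, hs⟩
    · simp [sgn] at hs
    · have h2 := hm _ (Or.inl rfl)
      exact ⟨lt_of_le_of_ne h2 hne, by simpa [sgn, neg_eq_iff_eq_neg] using hs⟩
  · rintro ⟨h2, h3⟩
    refine ⟨_, Or.inr rfl, ?_, by simp [sgn, h3]⟩
    rintro l (rfl | rfl)
    · exact h2.le
    · exact le_rfl

/-- The permutation of `±[n]` attached to a signed matching. -/
def permOfMatching (β : Fin n → Fin n × ℤˣ) (hβ : ∀ k, β (β k).1 = (k, (β k).2)) :
    Equiv.Perm (PMIdx n) :=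
  Function.Involutive.toPerm (fun x => ((β x.1).1, (β x.1).2 * x.2)) fun x => by
    simp [hβ, ← mul_assoc]

theorem permOfMatching_apply (β : Fin n → Fin n × ℤˣ) (hβ : ∀ k, β (β k).1 = (k, (β k).2))
    (x : PMIdx n) : permOfMatching β hβ x = ((β x.1).1, (β x.1).2 * x.2) := rfl

theorem permOfMatching_involutive (β : Fin n → Fin n × ℤˣ)
    (hβ : ∀ k, β (β k).1 = (k, (β k).2)) : Function.Involutive (permOfMatching β hβ) :=
  fun x => by simp [permOfMatching_apply, hβ, ← mul_assoc]

theorem permOfMatching_isPairing {β : Fin n → Fin n × ℤˣ} (hβ : ∀ k, β (β k).1 = (k, (β k).2))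
    (hne : ∀ k, (β k).1 ≠ k) : IsPairing (permOfMatching β hβ) :=
  isPairing_of_involutive (permOfMatching_involutive β hβ) fun x hx =>
    hne x.1 (by simpa [permOfMatching_apply] using congrArg Prod.fst hx)

theorem permOfMatching_isPM {β : Fin n → Fin n × ℤˣ} (hβ : ∀ k, β (β k).1 = (k, (β k).2))
    (hne : ∀ k, (β k).1 ≠ k) : IsPM (permOfMatching β hβ) := by
  constructor
  · ext1 x
    rw [Equiv.Perm.eq_inv_iff_eq]
    simp [delta, permOfMatching_apply, hβ, ← mul_assoc]
  · intro x hx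
    rw [sameCycle_iff_of_involutive (permOfMatching_involutive β hβ)] at hx
    rcases hx with hx | hx
    · have := congrArg Prod.snd hx
      simp only [delta, Equiv.coe_fn_mk] at this
      rcases Int.units_eq_one_or x.2 with h | h <;> rw [h] at this <;> revert this <;> decide
    · exact hne x.1 (by simpa [permOfMatching_apply, delta] using (congrArg Prod.fst hx).symm)

end PMIdx

/-! ### The sum over PM(n) as a sum over signed matchings -/

section SumOverPM

/-- The admissibility condition at the pair `k, -k`, for `α k = (l, s)`. -/
def EdgeAdmissible {n N : ℕ} (ι : PMIdx n → Fin N) (η : PMIdx n → ℤˣ) (k : Fin n)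
    (x : PMIdx n) : Prop :=
  ι (k, 1) = ι (x.1, -x.2) ∧ ι (k, -1) = ι x ∧
    η (k, 1) = x.2 * η (x.1, -x.2) ∧ η (k, -1) = x.2 * η x

/-- The sign attached to the end `k` of the edge from `k` to `x`. -/
def edgeSign {n : ℕ} (η : PMIdx n → ℤˣ) (k : Fin n) (x : PMIdx n) : ℤˣ :=
  if x.1 < k ∧ x.2 = -1 then η (k, 1) * η (k, -1) else 1

open Classical in
/-- The weight of the end `k` of the edge from `k` to `x`. -/
noncomputable def edgeWeight {n N : ℕ} (ι : PMIdx n → Fin N) (η : PMIdx n → ℤˣ) (k : Fin n)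
    (x : PMIdx n) : ℂ :=
  if EdgeAdmissible ι η k x then
    ((1 / √(2 * (N : ℝ)) : ℝ) : ℂ) * ((edgeSign η k x : ℤ) : ℂ) else 0

/-- Since α(-k) = -α(k), the conditions at k and -k can both be expressed through α(k). -/
theorem mem_admissiblePM_iff {n N : ℕ} (ι : PMIdx n → Fin N) (η : PMIdx n → ℤˣ)
    (α : {α : Equiv.Perm (PMIdx n) // PMIdx.IsPM α}) (hp : PMIdx.IsPairing α.1) :
    α ∈ admissiblePM ι η ↔ ∀ k, EdgeAdmissible ι η k (α.1 (k, 1)) := by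
  have h := α.2.apply_eq hp.involutive
  have hpos : ∀ k : Fin n, α.1 (k, 1) = ((α.1 (k, 1)).1, (α.1 (k, 1)).2) := fun k => rfl
  have hneg : ∀ k : Fin n, α.1 (k, -1) = ((α.1 (k, 1)).1, -(α.1 (k, 1)).2) := fun k => by
    simpa using h (k, -1)
  have hunits : ∀ p : ℤˣ → Prop, (∀ s, p s) ↔ p 1 ∧ p (-1) := fun p =>
    ⟨fun hp => ⟨hp _, hp _⟩, fun hp s => by
      rcases Int.units_eq_one_or s with rfl | rfl
      exacts [hp.1, hp.2]⟩
  simp only [admissiblePM, Finset.mem_filter, Finset.mem_univ, true_and, funext_iff, Prod.forall,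
    hunits, ← forall_and, EdgeAdmissible]
  refine forall_congr' fun k => ?_
  simp only [Function.comp_apply, Equiv.Perm.mul_apply, Pi.mul_apply, PMIdx.sgn, PMIdx.delta,
    Equiv.coe_fn_mk, hneg, one_mul, neg_neg, neg_mul, neg_inj, Prod.mk.eta]
  tauto

theorem fdSign_eq {n : ℕ} (η : PMIdx n → ℤˣ) {α : Equiv.Perm (PMIdx n)} (h : PMIdx.IsPM α)
    (hp : PMIdx.IsPairing α) : fdSign η α = ∏ k, edgeSign η k (α (k, 1)) := by
  classical
  rw [fdSign, Finset.prod_filter]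
  refine Finset.prod_congr rfl fun k _ => ?_
  rw [edgeSign]
  exact if_congr (h.neg_mem_FD_iff hp k) rfl rfl

theorem prod_edgeWeight {n N : ℕ} (ι : PMIdx n → Fin N) (η : PMIdx n → ℤˣ)
    {β : Fin n → PMIdx n} (h : ∀ k, EdgeAdmissible ι η k (β k)) :
    ∏ k, edgeWeight ι η k (β k) =
      ((∏ k, edgeSign η k (β k) : ℤˣ) : ℤ) * ((1 / √(2 * (N : ℝ)) : ℝ) : ℂ) ^ n := by
  simp only [edgeWeight, h, if_true, Finset.prod_mul_distrib]
  simp [mul_comm]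

theorem rpow_half_sub (N n : ℕ) (h : n ≠ 0 → N ≠ 0) :
    (2 * (N : ℝ)) ^ ((n : ℝ) / 2 - (n : ℝ)) = (1 / √(2 * (N : ℝ))) ^ n := by
  rcases eq_or_ne n 0 with rfl | hn
  · simp
  have hN : 0 < (2 * (N : ℝ)) := by
    have := Nat.pos_of_ne_zero (h hn)
    positivity
  rw [Real.sqrt_eq_rpow, one_div, ← Real.rpow_neg hN.le, ← Real.rpow_natCast, ← Real.rpow_mul hN.le]
  congr 1
  ring

theorem sum_admissiblePM_eq {n N : ℕ} (ι : PMIdx n → Fin N) (η : PMIdx n → ℤˣ) :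
    ∑ α ∈ admissiblePM ι η,
      ((fdSign η α.1 : ℤ) : ℂ) *
        (((2 * (N : ℝ)) ^ ((PMIdx.numCycles α.1 : ℝ) / 2 - (n : ℝ)) : ℝ) : ℂ) *
        gseWeight α =
      ∑ β ∈ signedMatchings (Finset.univ : Finset (Fin n)), ∏ k, edgeWeight ι η k (β k) := by
  classical
  -- If n > 0, a value of `ι` is an element of `Fin N`, so the base 2N of the real power is
  -- positive.
  have hN : n ≠ 0 → N ≠ 0 := by
    rintro hn rfl
    exact (ι (⟨0, Nat.pos_of_ne_zero hn⟩, 1)).elim0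
  simp only [gseWeight, mul_ite, mul_one, mul_zero]
  rw [← Finset.sum_filter]
  -- Matchings with an inadmissible edge have weight zero; the remaining ones correspond to the
  -- admissible pairings.
  have hz : ∀ β ∈ signedMatchings (Finset.univ : Finset (Fin n)),
      ∏ k, edgeWeight ι η k (β k) ≠ 0 → ∀ k, EdgeAdmissible ι η k (β k) := by
    intro β _ hβ k
    by_contra hk
    exact hβ (Finset.prod_eq_zero (Finset.mem_univ k) (by simp [edgeWeight, hk]))
  rw [← Finset.sum_filter_of_ne hz]
  refine Finset.sum_bij (fun α _ k => α.1 (k, 1)) ?_ ?_ ?_ ?_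
  · intro α hα
    rw [Finset.mem_filter] at hα
    obtain ⟨ha, hp⟩ := hα
    rw [Finset.mem_filter, mem_signedMatchings]
    refine ⟨⟨fun k => ?_, by simp, fun k _ => α.2.apply_fst_ne hp k⟩,
      (mem_admissiblePM_iff ι η α hp).1 ha⟩
    have h1 := hp.involutive (k, 1)
    rw [α.2.apply_eq hp.involutive (α.1 (k, 1)), Prod.mk.injEq] at h1
    exact Prod.ext h1.1 (by rw [← Int.units_inv_eq_self (α.1 (k, 1)).2]; exact eq_inv_of_mul_eq_one_left h1.2)
  · intro α hα α' hα' he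
    rw [Finset.mem_filter] at hα hα'
    refine Subtype.ext (Equiv.ext fun x => ?_)
    have : α.1 (x.1, 1) = α'.1 (x.1, 1) := congrFun he x.1
    rw [α.2.apply_eq hα.2.involutive, α'.2.apply_eq hα'.2.involutive, this]
  · intro β hβ
    rw [Finset.mem_filter, mem_signedMatchings] at hβ
    obtain ⟨⟨h1, -, h2⟩, h3⟩ := hβ
    have h2' : ∀ k, (β k).1 ≠ k := fun k => h2 k (Finset.mem_univ k)
    obtain ⟨α, hp, he⟩ : ∃ α : {α : Equiv.Perm (PMIdx n) // PMIdx.IsPM α},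
        PMIdx.IsPairing α.1 ∧ ∀ k : Fin n, α.1 (k, 1) = β k :=
      ⟨⟨PMIdx.permOfMatching β h1, PMIdx.permOfMatching_isPM h1 h2'⟩,
        PMIdx.permOfMatching_isPairing h1 h2', fun k => by simp [PMIdx.permOfMatching_apply]⟩
    refine ⟨α, ?_, funext he⟩
    rw [Finset.mem_filter]
    refine ⟨(mem_admissiblePM_iff ι η α hp).2 fun k => ?_, hp⟩
    rw [he]
    exact h3 k
  · intro α hα
    rw [Finset.mem_filter] at hα
    obtain ⟨ha, hp⟩ := hα
    rw [prod_edgeWeight ι η ((mem_admissiblePM_iff ι η α hp).1 ha), fdSign_eq η α.2 hp,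
      hp.numCycles_eq, rpow_half_sub N n hN, Complex.ofReal_pow]

end SumOverPM

/-- The covariance of two entries as a sum over the signs of the edge that joins them. -/
theorem sum_edgeWeight_mul {n N : ℕ} (ι : PMIdx n → Fin N) (η : PMIdx n → ℤˣ) {m l : Fin n}
    (hlm : l ≠ m) :
    ∑ s : ℤˣ, edgeWeight ι η m (l, s) * edgeWeight ι η l (m, s) =
      ((1 / √(2 * (N : ℝ)) : ℝ) : ℂ) ^ 2 *
        ((if ι (m, 1) = ι (l, -1) ∧ ι (m, -1) = ι (l, 1) ∧ η (m, 1) = η (l, -1) ∧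
            η (m, -1) = η (l, 1) then 1 else 0) +
          if ι (m, 1) = ι (l, 1) ∧ ι (m, -1) = ι (l, -1) ∧ η (m, 1) = -η (l, 1) ∧
            η (m, -1) = -η (l, -1) then (((η (m, 1) * η (m, -1) : ℤˣ) : ℤ) : ℂ) else 0) := by
  have hu : (Finset.univ : Finset ℤˣ) = {1, -1} := by decide
  have h11 : EdgeAdmissible ι η m (l, 1) ↔ ι (m, 1) = ι (l, -1) ∧ ι (m, -1) = ι (l, 1) ∧
      η (m, 1) = η (l, -1) ∧ η (m, -1) = η (l, 1) := by simp [EdgeAdmissible]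
  have h12 : EdgeAdmissible ι η l (m, 1) ↔ ι (m, 1) = ι (l, -1) ∧ ι (m, -1) = ι (l, 1) ∧
      η (m, 1) = η (l, -1) ∧ η (m, -1) = η (l, 1) := by
    simp only [EdgeAdmissible, one_mul]
    constructor <;> rintro ⟨h1, h2, h3, h4⟩ <;> exact ⟨h2.symm, h1.symm, h4.symm, h3.symm⟩
  have h21 : EdgeAdmissible ι η m (l, -1) ↔ ι (m, 1) = ι (l, 1) ∧ ι (m, -1) = ι (l, -1) ∧
      η (m, 1) = -η (l, 1) ∧ η (m, -1) = -η (l, -1) := by simp [EdgeAdmissible]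
  have h22 : EdgeAdmissible ι η l (m, -1) ↔ ι (m, 1) = ι (l, 1) ∧ ι (m, -1) = ι (l, -1) ∧
      η (m, 1) = -η (l, 1) ∧ η (m, -1) = -η (l, -1) := by
    simp only [EdgeAdmissible, neg_mul, one_mul, neg_neg]
    constructor <;> rintro ⟨h1, h2, h3, h4⟩ <;>
    exact ⟨h1.symm, h2.symm, by rw [h3, neg_neg], by rw [h4, neg_neg]⟩
  -- The positive edge gives the transposed term of the covariance, the negative edge the signed
  -- term.
  rw [hu, Finset.sum_pair (by decide), mul_add]
  congr 1
  · simp only [edgeWeight, h11, h12]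
    split_ifs
    · simp [edgeSign, show (1 : ℤˣ) ≠ -1 by decide]
      ring
    · simp
  · simp only [edgeWeight, h21, h22]
    split_ifs with h
    -- Only the larger end carries the sign. If that end is `l`, the product of its two η's still
    -- equals that at `m`, because admissibility negates both.
    · rcases lt_or_gt_of_ne hlm with h1 | h1
      · simp [edgeSign, h1, h1.not_gt]
        ring
      · simp [edgeSign, h1, h1.not_gt, h.2.2.1, h.2.2.2]
        ring
    · simp

theorem mainTheorem6 {Ω : Type*} [MeasurableSpace Ω] (P : Measure Ω) [IsProbabilityMeasure P]
    {N n : ℕ} (T : Ω → Matrix (Fin N) (Fin N) ℍ[ℝ]) (hT : IsGSE P T)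
    (ι : PMIdx n → Fin N) (η : PMIdx n → ℤˣ) :
    Integrable (fun ω => ∏ k : Fin n, matEntry (T ω) (ι (PMIdx.pos k)) (ι (PMIdx.neg k))
      (η (PMIdx.pos k)) (η (PMIdx.neg k))) P ∧
    ∫ ω, ∏ k : Fin n, matEntry (T ω) (ι (PMIdx.pos k)) (ι (PMIdx.neg k))
      (η (PMIdx.pos k)) (η (PMIdx.neg k)) ∂P =
    ∑ α ∈ admissiblePM ι η,
      ((fdSign η α.1 : ℤ) : ℂ) *
        (((2 * (N : ℝ)) ^ ((PMIdx.numCycles α.1 : ℝ) / 2 - (n : ℝ)) : ℝ) : ℂ) *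
        gseWeight α := by
  obtain ⟨hint, heq⟩ := hT.integrable_and_integral Finset.univ
    (fun k : Fin n => ι (PMIdx.pos k)) (fun k => ι (PMIdx.neg k))
    (fun k => η (PMIdx.pos k)) (fun k => η (PMIdx.neg k))
  refine ⟨hint, heq.trans ?_⟩
  rw [sum_admissiblePM_eq]
  -- The Gaussian expectation over an arbitrary subset of the factors is the functional that
  -- satisfies Wick's recursion.
  refine eq_sum_signedMatchings (edgeWeight ι η) (fun S => gaussianExp (1 / 4)
    (∏ k ∈ S, linForm (gseCoeff (ι (PMIdx.pos k)) (ι (PMIdx.neg k)) (η (PMIdx.pos k))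
      (η (PMIdx.neg k))))) (by simp [gaussianExp_one]) (fun S m hm => ?_) Finset.univ
  rw [gaussianExp_prod_linForm (by norm_num) _ hm]
  refine Finset.sum_congr rfl fun l hl => ?_
  rw [gseCoeff_cov, sum_edgeWeight_mul ι η (Finset.ne_of_mem_erase hl)]
  rfl
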